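/- Let $k$ be a field, $S=k[x_1,\dots,x_n]$, let $I\subset S$ be a monomial ideal, and let $R=S/I$. Let $K^R=\bigwedge^\bullet R^n$ be the Koszul complex of $R$ with respect to $x_1,\dots,x_n$, where $R^n$ has basis $e_1,\dots,e_n$ and $\partial(e_{\sigma_1}\wedge\dots\wedge e_{\sigma_p})=\sum_{j=1}^p(-1)^{j-1}x_{\sigma_j}\,e_{\sigma_1}\wedge\dots\wedge\widehat{e_{\sigma_j}}\wedge\dots\wedge e_{\sigma_p}$ for $\sigma_1<\dots<\sigma_p$. For $\sigma=\{\sigma_1<\dots<\sigma_p\}$ write $e_\sigma=e_{\sigma_1}\wedge\dots\wedge e_{\sigma_p}$. Let $G(I)$ be the set of minimal monomial generators of $I$, listed in an order $u_1,\dots,u_m$. Put $\operatorname{set}(u_j)=\{i : x_i\in (u_1,\dots,u_{j-1}):u_j\}$. For a monomial $v\in I$ let $g(v)=u_j$, where $j$ is the least index such that $u_j$ divides $v$. Suppose that, with respect to this order: 1. $I$ has linear quotients, i.e. $(u_1,\dots,u_{j-1}):u_j$ is generated by a subset of $\{x_1,\dots,x_n\}$ for every $j\ge 2$, and the order is degree-increasing,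 i.e. $\deg u_1\le\dots\le\deg u_m$; 2. the decomposition function $g$ is regular, i.e. $\operatorname{set}(g(x_su))\subseteq\operatorname{set}(u)$ for all $u\in G(I)$ and all $s\in\operatorname{set}(u)$; 3. $I$ has nice Koszul lifts, i.e. for each $u\in G(I)$ there is an index $\ell$ such that $x_\ell$ divides $u$ and $x_\ell$ divides $\frac{x_tu}{g(x_tu)}$ for all $t\in\operatorname{set}(u)$. For each $u\in G(I)$ choose any index $\ell=\ell(u)$ as in 3. Then for every $i\ge 1$ the elements $\left[\frac{u}{x_{\ell(u)}}\right]e_{\ell(u)}\wedge e_\sigma$ of $\bigwedge^i R^n$, where $u\in G(I)$, $\sigma\subseteq\operatorname{set}(u)$ and $|\sigma|=i-1$, are cycles, and their homology classes, indexed by the pairs $(u,\sigma)$, form a $k$-basis of the Koszul homology $H_i(K^R)$. -/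

import Mathlib

open MvPolynomial

namespace KoszulMonomialBasis

section LinearQuotients

/-! Monomials of `k[x_1, …, x_n]` are represented by their exponent vectors `a : Fin n →₀ ℕ`;
divisibility of monomials is the pointwise order on exponent vectors. -/

variable {n m : ℕ}

/-- `I` is generated by monomials. -/
def IsMonomialIdeal {k : Type*} [Field k] (I : Ideal (MvPolynomial (Fin n) k)) : Prop :=
  ∃ A : Set (Fin n →₀ ℕ), I = Ideal.span ((fun a => monomial a (1 : k)) '' A)

/-- `G(I)`: the monomials of `I` which are minimal with respect to divisibility, that is, the
minimal monomial generators of a monomial ideal `I`. -/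
def minGens {k : Type*} [Field k] (I : Ideal (MvPolynomial (Fin n) k)) : Set (Fin n →₀ ℕ) :=
  {a | Minimal (fun b : Fin n →₀ ℕ => monomial b (1 : k) ∈ I) a}

/-- The sequence `u_1, …, u_m` lists the minimal monomial generators of `I`, each once. -/
def IsGeneratorOrder {k : Type*} [Field k] (I : Ideal (MvPolynomial (Fin n) k))
    (u : Fin m → (Fin n →₀ ℕ)) : Prop :=
  Function.Injective u ∧ Set.range u = minGens I

/-- The colon ideal `(u_1, …, u_{j-1}) : u_j` of `k[x_1, …, x_n]`. -/
noncomputable def prevColon (k : Type*) [Field k] (u : Fin m → (Fin n →₀ ℕ)) (j : Fin m) :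
    Ideal (MvPolynomial (Fin n) k) :=
  (Ideal.span ((fun i => monomial (u i) (1 : k)) '' {i | i < j})).colon {monomial (u j) (1 : k)}

/-- `I` has linear quotients with respect to the order `u_1, …, u_m` of its minimal generators. -/
def HasLinearQuotients {k : Type*} [Field k] (I : Ideal (MvPolynomial (Fin n) k))
    (u : Fin m → (Fin n →₀ ℕ)) : Prop :=
  IsGeneratorOrder I u ∧
    ∀ j : Fin m, 0 < (j : ℕ) → ∃ A : Set (Fin n),
      prevColon k u j = Ideal.span ((fun i => (X i : MvPolynomial (Fin n) k)) '' A)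

/-- The order is degree-increasing: `deg u_1 ≤ … ≤ deg u_m`. -/
def DegreeIncreasing (u : Fin m → (Fin n →₀ ℕ)) : Prop :=
  Monotone fun j => (u j).degree

/-- `set(u_j) = {i : x_i ∈ (u_1, …, u_{j-1}) : u_j}`. -/
def genSet (k : Type*) [Field k] (u : Fin m → (Fin n →₀ ℕ)) (j : Fin m) : Set (Fin n) :=
  {i | (X i : MvPolynomial (Fin n) k) ∈ prevColon k u j}

/-- The monomials divisible by one of `u_1, …, u_m`. When these are the generators of a monomial
ideal `I`, this is the set `M(I)` of monomials in `I` (see `mem_iff_mem_multiples`). -/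
def multiples (u : Fin m → (Fin n →₀ ℕ)) : Set (Fin n →₀ ℕ) :=
  {v | ∃ j, u j ≤ v}

theorem mem_iff_mem_multiples {k : Type*} [Field k] {I : Ideal (MvPolynomial (Fin n) k)}
    {u : Fin m → (Fin n →₀ ℕ)} (hu : IsGeneratorOrder I u)
    (v : Fin n →₀ ℕ) : monomial v (1 : k) ∈ I ↔ v ∈ multiples u := by
  constructor
  · intro hv
    obtain ⟨a, hav, ha⟩ := exists_minimal_le_of_wellFoundedLT
      (fun b : Fin n →₀ ℕ => monomial b (1 : k) ∈ I) v hv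
    have : a ∈ Set.range u := by rw [hu.2]; exact ha
    obtain ⟨j, rfl⟩ := this
    exact ⟨j, hav⟩
  · rintro ⟨j, hj⟩
    have : u j ∈ minGens I := by rw [← hu.2]; exact ⟨j, rfl⟩
    exact I.mem_of_dvd (monomial_dvd_monomial.2 ⟨Or.inr hj, one_dvd _⟩) this.1

open Classical in
/-- The decomposition function `g`, with `G(I)` identified with its index set through the order:
`g v` is the least `j` such that `u_j` divides `v`. -/
noncomputable def decomp (u : Fin m → (Fin n →₀ ℕ)) (v : multiples u) : Fin m :=
  (Finset.univ.filter fun j => u j ≤ v.1).min'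
    (v.2.imp fun _ hj => Finset.mem_filter.2 ⟨Finset.mem_univ _, hj⟩)

/-- The monomial `x_t u_j`, as an element of `M(I)`. -/
noncomputable def xMul (u : Fin m → (Fin n →₀ ℕ)) (t : Fin n) (j : Fin m) : multiples u :=
  ⟨u j + Finsupp.single t 1, j, le_self_add⟩

/-- The decomposition function is regular: `set(g(x_s u)) ⊆ set(u)` for all generators `u` and
all `s ∈ set(u)`. -/
def IsRegularDecomp (k : Type*) [Field k] (u : Fin m → (Fin n →₀ ℕ)) : Prop :=
  ∀ j : Fin m, ∀ s ∈ genSet k u j, genSet k u (decomp u (xMul u s j)) ⊆ genSet k u j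

/-- The index `ℓ` lies in the support of `u_j`, and `x_ℓ` divides `x_t u_j / g(x_t u_j)` for all
`t ∈ set(u_j)`. -/
def IsNiceLiftIndex (k : Type*) [Field k] (u : Fin m → (Fin n →₀ ℕ)) (j : Fin m)
    (l : Fin n) : Prop :=
  l ∈ (u j).support ∧
    ∀ t ∈ genSet k u j,
      Finsupp.single l 1 ≤ (xMul u t j : Fin n →₀ ℕ) - u (decomp u (xMul u t j))

/-- Nice Koszul lifts, with respect to the given order of the generators. -/
def HasNiceKoszulLifts (k : Type*) [Field k] (u : Fin m → (Fin n →₀ ℕ)) : Prop :=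
  ∀ j : Fin m, ∃ l : Fin n, IsNiceLiftIndex k u j l

end LinearQuotients

section Koszul

/-! The Koszul complex of a commutative ring `R` with respect to `x_1, …, x_n ∈ R`. -/

variable {n : ℕ} {R : Type*} [CommRing R]

/-- The basis element `e_σ = e_{σ_1} ∧ … ∧ e_{σ_p}`, for `σ = {σ_1 < … < σ_p}`. -/
noncomputable def e (R : Type*) [CommRing R] (σ : Finset (Fin n)) :
    ExteriorAlgebra R (Fin n → R) :=
  (Pi.basisFun R (Fin n)).ExteriorAlgebra σ

/-- The linear form `Rⁿ → R` sending `e_i` to `x_i`. -/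
noncomputable def koszulForm (x : Fin n → R) : Module.Dual R (Fin n → R) :=
  Fintype.linearCombination R x

/-- The Koszul boundary map `∂` on `⋀ Rⁿ` with respect to `x_1, …, x_n`: contraction with
`koszulForm x`. It is the `R`-linear map with `∂ 1 = 0` and `∂ (e_i ∧ w) = x_i w - e_i ∧ ∂ w`,
whence `∂ e_σ = ∑_j (-1)^#{s ∈ σ : s < σ_j} x_{σ_j} e_{σ \ σ_j}`. -/
noncomputable def koszulD (x : Fin n → R) :
    ExteriorAlgebra R (Fin n → R) →ₗ[R] ExteriorAlgebra R (Fin n → R) :=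
  CliffordAlgebra.contractLeft (Q := (0 : QuadraticForm R (Fin n → R))) (koszulForm x)

theorem koszulD_one (x : Fin n → R) : koszulD x 1 = 0 :=
  CliffordAlgebra.contractLeft_one (Q := (0 : QuadraticForm R (Fin n → R))) (koszulForm x)

theorem koszulD_ι_mul (x : Fin n → R) (v : Fin n → R) (w : ExteriorAlgebra R (Fin n → R)) :
    koszulD x (ExteriorAlgebra.ι R v * w) =
      koszulForm x v • w - ExteriorAlgebra.ι R v * koszulD x w :=
  CliffordAlgebra.contractLeft_ι_mul (Q := (0 : QuadraticForm R (Fin n → R))) (d := koszulForm x) v w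

theorem koszulD_koszulD (x : Fin n → R) (w : ExteriorAlgebra R (Fin n → R)) :
    koszulD x (koszulD x w) = 0 :=
  CliffordAlgebra.contractLeft_contractLeft (Q := (0 : QuadraticForm R (Fin n → R))) (koszulForm x) w

/-- `∂` maps `⋀^{p+1} Rⁿ` into `⋀^p Rⁿ`. -/
theorem koszulD_mem (x : Fin n → R) (p : ℕ) {w : ExteriorAlgebra R (Fin n → R)}
    (hw : w ∈ ⋀[R]^(p + 1) (Fin n → R)) : koszulD x w ∈ ⋀[R]^p (Fin n → R) := by
  induction p generalizing w with
  | zero =>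
    rw [ExteriorAlgebra.exteriorPower, zero_add, pow_one] at hw
    obtain ⟨v, rfl⟩ := hw
    have := koszulD_ι_mul x v 1
    rw [mul_one, koszulD_one, mul_zero, sub_zero] at this
    rw [this, ExteriorAlgebra.exteriorPower, pow_zero]
    exact Submodule.smul_mem _ _ (Submodule.one_le.1 le_rfl)
  | succ p ih =>
    rw [ExteriorAlgebra.exteriorPower, pow_succ'] at hw
    refine Submodule.mul_induction_on hw ?_ ?_
    · rintro _ ⟨v, rfl⟩ w hw
      rw [koszulD_ι_mul]
      refine Submodule.sub_mem _ (Submodule.smul_mem _ _ hw) ?_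
      rw [ExteriorAlgebra.exteriorPower, pow_succ']
      exact Submodule.mul_mem_mul ⟨v, rfl⟩ (ih hw)
    · intro a b ha hb
      rw [map_add]
      exact Submodule.add_mem _ ha hb

/-- The cycles `Z_p ⊆ ⋀^p Rⁿ` of the Koszul complex. -/
noncomputable def cycles (x : Fin n → R) (p : ℕ) : Submodule R (ExteriorAlgebra R (Fin n → R)) :=
  (⋀[R]^p (Fin n → R)) ⊓ LinearMap.ker (koszulD x)

/-- The boundaries `B_p = ∂(⋀^{p+1} Rⁿ)` of the Koszul complex. -/
noncomputable def boundaries (x : Fin n → R) (p : ℕ) :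
    Submodule R (ExteriorAlgebra R (Fin n → R)) :=
  (⋀[R]^(p + 1) (Fin n → R)).map (koszulD x)

theorem boundaries_le_cycles (x : Fin n → R) (p : ℕ) : boundaries x p ≤ cycles x p := by
  rintro _ ⟨w, hw, rfl⟩
  exact ⟨koszulD_mem x p hw, koszulD_koszulD x w⟩

/-- The Koszul homology `H_p = Z_p / B_p`. -/
abbrev KoszulHomology (x : Fin n → R) (p : ℕ) : Type _ :=
  cycles x p ⧸ (boundaries x p).submoduleOf (cycles x p)

/-- The homology class of a cycle. -/
noncomputable def homologyClass (x : Fin n → R) (p : ℕ) (z : cycles x p) : KoszulHomology x p :=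
  Submodule.Quotient.mk z

end Koszul

section MonomialRing

variable {n : ℕ} {k : Type*} [Field k]

/-- The classes of the variables `x_1, …, x_n` in `R = k[x_1, …, x_n] / I`. The complex `K^R` is
the Koszul complex of `R` with respect to this sequence. -/
noncomputable def vars (I : Ideal (MvPolynomial (Fin n) k)) : Fin n → MvPolynomial (Fin n) k ⧸ I :=
  fun i => Ideal.Quotient.mk I (X i)

/-- The element `[a / x_ℓ] e_ℓ ∧ e_σ` of `⋀ Rⁿ`, for a monomial `a` divisible by `x_ℓ`;
`e_ℓ` is the image of the `ℓ`-th standard basis vector of `Rⁿ`. -/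
noncomputable def monomialChain (I : Ideal (MvPolynomial (Fin n) k)) (a : Fin n →₀ ℕ)
    (l : Fin n) (σ : Finset (Fin n)) :
    ExteriorAlgebra (MvPolynomial (Fin n) k ⧸ I) (Fin n → MvPolynomial (Fin n) k ⧸ I) :=
  Ideal.Quotient.mk I (monomial (a - Finsupp.single l 1) (1 : k)) •
    (ExteriorAlgebra.ι _ (Pi.single l 1) * e _ σ)

/-- The index set of the basis in homological degree `i`: pairs of a generator `u_j` and a subset
`σ ⊆ set(u_j)` with `|σ| = i - 1`. -/
abbrev BasisIndex (k : Type*) [Field k] {m : ℕ} (u : Fin m → (Fin n →₀ ℕ)) (i : ℕ) : Type :=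
  {p : Fin m × Finset (Fin n) // (p.2 : Set (Fin n)) ⊆ genSet k u p.1 ∧ p.2.card + 1 = i}

end MonomialRing

end KoszulMonomialBasis

namespace KoszulMonomialBasis

/-! ### The free basis `e σ`, and submodules `I · ⋀ Rⁿ` tested on coefficients -/

section ExteriorBasis

variable {n : ℕ} {R : Type*} [CommRing R]

/-! Let `K` be the Koszul complex of `S = k[x_1, …, x_n]`, put `J = (u_1, …, u_{j-1})`, `u = u_j`
and `A = set(u)`. Since `J : u = (A)`, multiplication by `u` gives a short exact sequence `0 → S/(A)
→ S/J → S/(J + (u)) → 0`. The Koszul homology of `S/(A)` is the exterior algebra over `k` on the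
`e_t`, `t ∈ A` (`isHomologyComplement_constSpan`). The niceness of `ℓ` gives `x_t u/x_ℓ ∈ J` for `t
∈ A` (`X_mul_monomial_mem_initialIdeal`). Hence, modulo `J`, the element `u e_σ` is the boundary of
`(u/x_ℓ) e_ℓ ∧ e_σ` for every `σ ⊆ A` (`koszulD_wedgeLift_sub_mem`). So multiplication by `u` is
zero on homology, the long exact sequence breaks into short ones, and these lifts are the new
classes that appear when `u` is adjoined (`spanning_sup`, `indep_sup`). Induction along the
generators finishes the argument (`isHomologyComplement_liftSet`).

No homology modules are formed in the induction. A complex over `S/J` is handled by elements of `K`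
modulo `J · K`, with all exterior degrees together. Passage to `R = S/I` and to a single degree
comes last. -/

theorem e_eq_ιMulti (σ : Finset (Fin n)) :
    e R σ = ExteriorAlgebra.ιMulti R σ.card
      (fun i => Pi.single (σ.orderEmbOfFin rfl i) (1 : R)) := by
  rw [e, ExteriorAlgebra.basis_apply_ofCard _ rfl]
  simp only [ExteriorAlgebra.ιMulti_family]
  congr 1
  funext i
  simp [Set.powersetCard.ofFinEmbEquiv_symm_apply]

theorem e_empty : e R (∅ : Finset (Fin n)) = 1 := by
  rw [e_eq_ιMulti]
  exact ExteriorAlgebra.ιMulti_zero_apply _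

theorem e_singleton (j : Fin n) : e R {j} = ExteriorAlgebra.ι R (Pi.single j 1) := by
  have h (i : Fin ({j} : Finset (Fin n)).card) : ({j} : Finset (Fin n)).orderEmbOfFin rfl i = j :=
    Finset.mem_singleton.1 (Finset.orderEmbOfFin_mem _ rfl i)
  rw [e_eq_ιMulti, ExteriorAlgebra.ιMulti_apply]
  simp [h]

/-- The sign can stay unspecified: the applications concern spans and submodules only. -/
theorem ι_mul_e {j : Fin n} {τ : Finset (Fin n)} (h : j ∉ τ) :
    ∃ ε : ℤˣ, ExteriorAlgebra.ι R (Pi.single j 1) * e R τ = ε • e R (insert j τ) := by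
  have hd : Disjoint ({j} : Finset (Fin n)) τ := by simpa using h
  have := ExteriorAlgebra.basis_mul_of_disjoint (Pi.basisFun R (Fin n))
    (Set.powersetCard.ofCard (s := {j}) rfl) (Set.powersetCard.ofCard (s := τ) rfl) hd
  rw [← e_singleton]
  rw [Finset.insert_eq, ← Finset.disjUnion_eq_union _ _ hd]
  exact ⟨_, this⟩

theorem e_mem_exteriorPower (σ : Finset (Fin n)) : e R σ ∈ ⋀[R]^(σ.card) (Fin n → R) := by
  rw [e_eq_ιMulti]
  exact ExteriorAlgebra.ιMulti_range R _ ⟨_, rfl⟩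

theorem sum_repr_smul_e (w : ExteriorAlgebra R (Fin n → R)) :
    ∑ σ, (Pi.basisFun R (Fin n)).ExteriorAlgebra.repr w σ • e R σ = w :=
  (Pi.basisFun R (Fin n)).ExteriorAlgebra.sum_repr w

/-- The submodule `I · ⋀ Rⁿ`. -/
abbrev koszulIdeal (I : Ideal R) : Submodule R (ExteriorAlgebra R (Fin n → R)) :=
  I • ⊤

theorem mem_koszulIdeal_iff_repr {I : Ideal R} {w : ExteriorAlgebra R (Fin n → R)} :
    w ∈ koszulIdeal I ↔
      ∀ σ, (Pi.basisFun R (Fin n)).ExteriorAlgebra.repr w σ ∈ I := by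
  constructor
  · intro h σ
    refine Submodule.smul_induction_on h (fun r hr x _ => ?_) (fun x y hx hy => ?_)
    · simpa using I.mul_mem_right _ hr
    · simpa using I.add_mem hx hy
  · intro h
    rw [← sum_repr_smul_e w]
    exact Submodule.sum_mem _ fun σ _ => Submodule.smul_mem_smul (h σ) Submodule.mem_top

theorem map_mem_koszulIdeal {I : Ideal R} {w : ExteriorAlgebra R (Fin n → R)}
    (f : ExteriorAlgebra R (Fin n → R) →ₗ[R] ExteriorAlgebra R (Fin n → R))
    (hw : w ∈ koszulIdeal I) :
    f w ∈ koszulIdeal I := by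
  have := Submodule.mem_map_of_mem (f := f) hw
  rw [Submodule.map_smul''] at this
  exact Submodule.smul_mono le_rfl le_top this

theorem mul_mem_koszulIdeal {I : Ideal R} {w : ExteriorAlgebra R (Fin n → R)}
    (v : ExteriorAlgebra R (Fin n → R))
    (hw : w ∈ koszulIdeal I) :
    v * w ∈ koszulIdeal I :=
  map_mem_koszulIdeal (LinearMap.mulLeft R v) hw

/-- Checked on coefficients. This is the injectivity of multiplication by `r` from the complex over
`R/(I : r)` to the complex over `R/I`. -/
theorem smul_mem_koszulIdeal_iff_colon {I : Ideal R} {r : R} {w : ExteriorAlgebra R (Fin n → R)} :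
    r • w ∈ koszulIdeal I ↔
      w ∈ koszulIdeal (I.colon {r}) := by
  simp [mem_koszulIdeal_iff_repr, Submodule.mem_colon_singleton, mul_comm]

theorem koszulForm_single (x : Fin n → R) (j : Fin n) :
    koszulForm x (Pi.single j 1) = x j := by
  simp [koszulForm]

theorem koszulD_mem_koszulIdeal {x : Fin n → R} {I : Ideal R} (hx : ∀ i, x i ∈ I)
    (w : ExteriorAlgebra R (Fin n → R)) :
    koszulD x w ∈ koszulIdeal I := by
  induction w using CliffordAlgebra.left_induction with
  | algebraMap r =>
    rw [Algebra.algebraMap_eq_smul_one, map_smul, koszulD_one, smul_zero]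
    exact Submodule.zero_mem _
  | add a b ha hb => rw [map_add]; exact Submodule.add_mem _ ha hb
  | ι_mul w v hw =>
    have h := koszulD_ι_mul x v w
    rw [ExteriorAlgebra.ι] at h
    rw [h]
    refine Submodule.sub_mem _ (Submodule.smul_mem_smul ?_ Submodule.mem_top)
      (mul_mem_koszulIdeal _ hw)
    rw [koszulForm, Fintype.linearCombination_apply]
    exact I.sum_mem fun i _ => I.mul_mem_left _ (hx i)

/-- Only the `x i` with `i ∈ σ` occur as coefficients of `∂ e_σ`. -/
theorem koszulD_e_mem_koszulIdeal {x : Fin n → R} {I : Ideal R} {σ : Finset (Fin n)}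
    (hx : ∀ i ∈ σ, x i ∈ I) :
    koszulD x (e R σ) ∈ koszulIdeal I := by
  induction σ using Finset.induction_on with
  | empty => rw [e_empty, koszulD_one]; exact Submodule.zero_mem _
  | insert j τ hj ih =>
    obtain ⟨ε, hε⟩ := ι_mul_e (R := R) hj
    have h : e R (insert j τ) = (ε⁻¹ : ℤˣ) • (ExteriorAlgebra.ι R (Pi.single j 1) * e R τ) := by
      rw [hε, inv_smul_smul]
    rw [h, Units.smul_def, map_zsmul, koszulD_ι_mul, koszulForm_single]
    refine zsmul_mem (Submodule.sub_mem _ (Submodule.smul_mem_smul (hx j (by simp)) Submodule.mem_top)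
      (mul_mem_koszulIdeal _ (ih fun i hi => hx i (by simp [hi])))) _

end ExteriorBasis
-- Koszul homology modulo an ideal generated by variables
section PolynomialRing

variable {n : ℕ} {k : Type*} [Field k]

/-- A set `F` of cycles modulo `I` in the Koszul complex of `k[x_1, …, x_n]` which maps bijectively
onto the homology of the Koszul complex modulo `I`. -/
structure IsHomologyComplement (I : Ideal (MvPolynomial (Fin n) k))
    (F : Set (ExteriorAlgebra (MvPolynomial (Fin n) k) (Fin n → MvPolynomial (Fin n) k))) :
    Prop where
  cycle : ∀ f ∈ F, koszulD X f ∈ koszulIdeal I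
  spanning : ∀ w, koszulD X w ∈ koszulIdeal I → ∃ f ∈ F, ∃ y, w - (f + koszulD X y) ∈ koszulIdeal I
  indep : ∀ f ∈ F, ∀ y, f - koszulD X y ∈ koszulIdeal I → f = 0

/-- The `k`-span of the `e_σ` with `σ ⊆ A`. -/
noncomputable def constSpan (k : Type*) [Field k] (A : Set (Fin n)) :
    Submodule k (ExteriorAlgebra (MvPolynomial (Fin n) k) (Fin n → MvPolynomial (Fin n) k)) :=
  Submodule.span k (e (MvPolynomial (Fin n) k) '' {σ | (σ : Set (Fin n)) ⊆ A})

/-- The ideal generated by the variables in `A`. -/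
noncomputable abbrev varIdeal (k : Type*) [Field k] (A : Set (Fin n)) :
    Ideal (MvPolynomial (Fin n) k) :=
  Ideal.span (X '' A)

theorem varIdeal_mono {A B : Set (Fin n)} (h : A ⊆ B) : varIdeal k A ≤ varIdeal k B :=
  Ideal.span_mono (Set.image_mono h)

theorem X_mem_varIdeal {A : Set (Fin n)} {i : Fin n} (h : i ∈ A) :
    (X i : MvPolynomial (Fin n) k) ∈ varIdeal k A :=
  Ideal.subset_span ⟨i, h, rfl⟩

theorem C_mem_varIdeal {A : Set (Fin n)} {c : k} (h : C c ∈ varIdeal k A) : c = 0 := by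
  by_contra hc
  obtain ⟨i, -, hi⟩ := mem_ideal_span_X_image.1 h 0 (by simpa using hc)
  simp at hi

theorem sub_C_mem_varIdeal (f : MvPolynomial (Fin n) k) :
    f - C (constantCoeff f) ∈ varIdeal k Set.univ := by
  refine mem_ideal_span_X_image.2 fun s hs => ?_
  by_contra! h
  have : s = 0 := by ext i; simpa using h i trivial
  subst this
  simp [constantCoeff_eq] at hs

/-- A variable outside `A` is a nonzerodivisor modulo `(A)`: multiplying a monomial by it does not
change the exponents at `A`. -/
theorem mem_varIdeal_of_X_mul {A : Set (Fin n)} {j : Fin n} (hj : j ∉ A)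
    {f : MvPolynomial (Fin n) k} (h : X j * f ∈ varIdeal k A) : f ∈ varIdeal k A := by
  refine mem_ideal_span_X_image.2 fun s hs => ?_
  obtain ⟨i, hi, h0⟩ := mem_ideal_span_X_image.1 h (Finsupp.single j 1 + s)
    (by simpa [coeff_X_mul] using hs)
  refine ⟨i, hi, ?_⟩
  have : j ≠ i := fun h => hj (h ▸ hi)
  simpa [Finsupp.single_apply, this] using h0

theorem mem_koszulIdeal_of_X_smul {A : Set (Fin n)} {j : Fin n} (hj : j ∉ A)
    {w : ExteriorAlgebra (MvPolynomial (Fin n) k) (Fin n → MvPolynomial (Fin n) k)}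
    (h : (X j : MvPolynomial (Fin n) k) • w ∈ koszulIdeal (varIdeal k A)) :
    w ∈ koszulIdeal (varIdeal k A) := by
  rw [mem_koszulIdeal_iff_repr] at h ⊢
  exact fun σ => mem_varIdeal_of_X_mul hj (by simpa using h σ)

theorem koszulIdeal_mono {R : Type*} [CommRing R] {I J : Ideal R} (h : I ≤ J) :
    (koszulIdeal I : Submodule R (ExteriorAlgebra R (Fin n → R))) ≤ koszulIdeal J :=
  Submodule.smul_mono h le_rfl

theorem exists_of_mem_koszulIdeal_sup {R : Type*} [CommRing R] {I : Ideal R} {r : R}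
    {w : ExteriorAlgebra R (Fin n → R)} (h : w ∈ koszulIdeal (I ⊔ Ideal.span {r})) :
    ∃ a ∈ koszulIdeal I, ∃ v, w = a + r • v := by
  rw [koszulIdeal, Submodule.sup_smul, Submodule.ideal_span_singleton_smul] at h
  obtain ⟨a, ha, b, hb, rfl⟩ := Submodule.mem_sup.1 h
  obtain ⟨v, -, rfl⟩ := (Submodule.mem_smul_pointwise_iff_exists _ _ _).1 hb
  exact ⟨a, ha, v, rfl⟩

theorem koszulD_mem_of_mem_constSpan {A : Set (Fin n)}
    {q : ExteriorAlgebra (MvPolynomial (Fin n) k) (Fin n → MvPolynomial (Fin n) k)}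
    (hq : q ∈ constSpan k A) : koszulD X q ∈ koszulIdeal (varIdeal k A) := by
  rw [constSpan] at hq
  induction hq using Submodule.span_induction with
  | mem x h =>
    obtain ⟨σ, hσ, rfl⟩ := h
    exact koszulD_e_mem_koszulIdeal fun i hi => X_mem_varIdeal (hσ hi)
  | zero => rw [map_zero]; exact Submodule.zero_mem _
  | add a b _ _ ha hb => rw [map_add]; exact Submodule.add_mem _ ha hb
  | smul c a _ ha =>
    rw [← algebraMap_smul (MvPolynomial (Fin n) k) c a, map_smul]
    exact Submodule.smul_mem _ _ ha

theorem exists_repr_eq_C_of_mem_constSpan {A : Set (Fin n)}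
    {q : ExteriorAlgebra (MvPolynomial (Fin n) k) (Fin n → MvPolynomial (Fin n) k)}
    (hq : q ∈ constSpan k A) (σ : Finset (Fin n)) :
    ∃ c : k, (Pi.basisFun (MvPolynomial (Fin n) k) (Fin n)).ExteriorAlgebra.repr q σ = C c := by
  rw [constSpan] at hq
  induction hq using Submodule.span_induction with
  | mem x h =>
    obtain ⟨τ, hτ, rfl⟩ := h
    rw [e, Module.Basis.repr_self, Finsupp.single_apply]
    split_ifs
    exacts [⟨1, by simp⟩, ⟨0, by simp⟩]
  | zero => exact ⟨0, by simp⟩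
  | add a b _ _ ha hb =>
    obtain ⟨c, hc⟩ := ha
    obtain ⟨d, hd⟩ := hb
    exact ⟨c + d, by simp [hc, hd]⟩
  | smul c a _ ha =>
    obtain ⟨d, hd⟩ := ha
    exact ⟨c * d, by
      rw [← algebraMap_smul (MvPolynomial (Fin n) k) c a, map_smul]; simp [hd, algebraMap_eq]⟩

/-- The coefficients of `q` are constants, and an ideal generated by variables contains no nonzero
constant. -/
theorem eq_zero_of_mem_constSpan {A B : Set (Fin n)}
    {q : ExteriorAlgebra (MvPolynomial (Fin n) k) (Fin n → MvPolynomial (Fin n) k)}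
    (hq : q ∈ constSpan k A) (h : q ∈ koszulIdeal (varIdeal k B)) : q = 0 := by
  refine (Pi.basisFun (MvPolynomial (Fin n) k) (Fin n)).ExteriorAlgebra.ext_elem fun σ => ?_
  obtain ⟨c, hc⟩ := exists_repr_eq_C_of_mem_constSpan hq σ
  have := mem_koszulIdeal_iff_repr.1 h σ
  rw [hc] at this
  simp [hc, C_mem_varIdeal this]

theorem e_mem_constSpan {A : Set (Fin n)} {σ : Finset (Fin n)} (h : (σ : Set (Fin n)) ⊆ A) :
    e (MvPolynomial (Fin n) k) σ ∈ constSpan k A :=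
  Submodule.subset_span ⟨σ, h, rfl⟩

theorem exists_of_mem_constSpan_insert {A : Set (Fin n)} {j : Fin n}
    {q : ExteriorAlgebra (MvPolynomial (Fin n) k) (Fin n → MvPolynomial (Fin n) k)}
    (hq : q ∈ constSpan k (insert j A)) :
    ∃ a ∈ constSpan k A, ∃ b ∈ constSpan k A,
      q = a + ExteriorAlgebra.ι (MvPolynomial (Fin n) k) (Pi.single j 1) * b := by
  rw [constSpan] at hq
  induction hq using Submodule.span_induction with
  | mem x h =>
    obtain ⟨σ, hσ, rfl⟩ := h
    by_cases hj : j ∈ σ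
    · obtain ⟨ε, hε⟩ := ι_mul_e (R := MvPolynomial (Fin n) k) (Finset.notMem_erase j σ)
      rw [Finset.insert_erase hj] at hε
      refine ⟨0, zero_mem _, (ε⁻¹ : ℤˣ) • e _ (σ.erase j), ?_, ?_⟩
      · rw [Units.smul_def]
        refine zsmul_mem (e_mem_constSpan fun i hi => ?_) _
        have hi' := Finset.mem_erase.1 (Finset.mem_coe.1 hi)
        exact (hσ hi'.2).resolve_left hi'.1
      · rw [Units.smul_def, mul_smul_comm, hε, ← Units.smul_def, inv_smul_smul, zero_add]
    · refine ⟨_, e_mem_constSpan fun i hi => (hσ hi).resolve_left ?_, 0, zero_mem _, by simp⟩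
      rintro rfl
      exact hj hi
  | zero => exact ⟨0, zero_mem _, 0, zero_mem _, by simp⟩
  | add x y _ _ hx hy =>
    obtain ⟨a, ha, b, hb, rfl⟩ := hx
    obtain ⟨a', ha', b', hb', rfl⟩ := hy
    exact ⟨a + a', add_mem ha ha', b + b', add_mem hb hb', by rw [mul_add]; abel⟩
  | smul c x _ hx =>
    obtain ⟨a, ha, b, hb, rfl⟩ := hx
    exact ⟨c • a, Submodule.smul_mem _ _ ha, c • b, Submodule.smul_mem _ _ hb, by
      rw [smul_add, mul_smul_comm]⟩

/-- Boundaries, like `(A) · K`, have all coefficients in the maximal ideal of the variables, while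
`q` has constant coefficients. -/
theorem indep_constSpan (A : Set (Fin n)) :
    ∀ q ∈ constSpan k A, ∀ y, q - koszulD X y ∈ koszulIdeal (varIdeal k A) → q = 0 := by
  intro q hq y h
  refine eq_zero_of_mem_constSpan (B := Set.univ) hq ?_
  have := Submodule.add_mem _ (koszulIdeal_mono (varIdeal_mono (Set.subset_univ A)) h)
    (koszulD_mem_koszulIdeal (fun i => X_mem_varIdeal (k := k) (Set.mem_univ i)) y)
  rwa [sub_add_cancel] at this

/-- Modulo all the variables, each coefficient equals its constant term. -/
theorem isHomologyComplement_constSpan_univ :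
    IsHomologyComplement (varIdeal k (Set.univ : Set (Fin n)))
      (constSpan k (Set.univ : Set (Fin n)) : Set _) where
  cycle f hf := koszulD_mem_of_mem_constSpan hf
  indep := indep_constSpan _
  spanning w _ := by
    let b := (Pi.basisFun (MvPolynomial (Fin n) k) (Fin n)).ExteriorAlgebra
    refine ⟨∑ σ, constantCoeff (b.repr w σ) • e _ σ,
      sum_mem fun σ _ => Submodule.smul_mem _ _ (e_mem_constSpan (Set.subset_univ _)), 0, ?_⟩
    rw [map_zero, add_zero]
    nth_rw 1 [← sum_repr_smul_e w]
    rw [← Finset.sum_sub_distrib]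
    refine sum_mem fun σ _ => ?_
    rw [← algebraMap_smul (MvPolynomial (Fin n) k) (constantCoeff (b.repr w σ)), ← sub_smul,
      algebraMap_eq]
    exact Submodule.smul_mem_smul (sub_C_mem_varIdeal _) Submodule.mem_top

/-- Since `x_j` is regular modulo `(A)`, a cycle modulo `(A)` cannot have a class involving `e_j`
when it is viewed modulo `(A, x_j)`; what remains lifts to a class modulo `(A)`. -/
theorem isHomologyComplement_constSpan_of_insert {A : Set (Fin n)} {j : Fin n} (hj : j ∉ A)
    (h : IsHomologyComplement (varIdeal k (insert j A)) (constSpan k (insert j A) : Set _)) :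
    IsHomologyComplement (varIdeal k A) (constSpan k A : Set _) where
  cycle f hf := koszulD_mem_of_mem_constSpan hf
  indep := indep_constSpan _
  spanning w hw := by
    obtain ⟨f, hf, y, hy⟩ :=
      h.spanning w (koszulIdeal_mono (varIdeal_mono (Set.subset_insert j A)) hw)
    obtain ⟨p, hp, q, hq, rfl⟩ := exists_of_mem_constSpan_insert hf
    have hJ : varIdeal k (insert j A) = varIdeal k A ⊔ Ideal.span {X j} := by
      rw [varIdeal, Set.image_insert_eq, Ideal.span_insert, sup_comm]
    rw [hJ] at hy
    obtain ⟨a, ha, v, hv⟩ := exists_of_mem_koszulIdeal_sup hy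
    set ej := ExteriorAlgebra.ι (MvPolynomial (Fin n) k)
      (Pi.single j 1 : Fin n → MvPolynomial (Fin n) k)
    have hι (z) : koszulD X (ej * z) = (X j : MvPolynomial (Fin n) k) • z - ej * koszulD X z := by
      rw [koszulD_ι_mul, koszulForm_single]
    have hw' : w = p + ej * q + koszulD X y + a + (X j : MvPolynomial (Fin n) k) • v := by
      rw [sub_eq_iff_eq_add] at hv
      rw [hv]; abel
    have hDp := koszulD_mem_of_mem_constSpan hp
    have hDq := mul_mem_koszulIdeal ej (koszulD_mem_of_mem_constSpan hq)
    have hDa := map_mem_koszulIdeal (koszulD X) ha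
    -- In `∂ w`, every term other than `x_j (q + ∂ v)` lies in `(A) · K`, so `x_j` can be cancelled.
    have hqv : q + koszulD X v ∈ koszulIdeal (varIdeal k A) := by
      refine mem_koszulIdeal_of_X_smul hj ?_
      have e1 : koszulD X w = koszulD X p + ((X j : MvPolynomial (Fin n) k) • q - ej * koszulD X q)
          + koszulD X a + (X j : MvPolynomial (Fin n) k) • koszulD X v := by
        rw [hw']
        simp only [map_add, map_smul, koszulD_koszulD, hι]
        abel
      have e2 : (X j : MvPolynomial (Fin n) k) • (q + koszulD X v) =
          koszulD X w - koszulD X p + ej * koszulD X q - koszulD X a := by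
        rw [e1, smul_add]; abel
      rw [e2]
      exact sub_mem (add_mem (sub_mem hw hDp) hDq) hDa
    have hq0 : q = 0 := indep_constSpan A q hq (-v) (by rwa [map_neg, sub_neg_eq_add])
    subst hq0
    rw [zero_add] at hqv
    -- The remainder `x_j v` is absorbed by `∂ (e_j ∧ v) = x_j v - e_j ∧ ∂ v`, where now `∂ v ∈ (A)
    -- · K`.
    refine ⟨p, hp, y + ej * v, ?_⟩
    have : w - (p + koszulD X (y + ej * v)) = a + ej * koszulD X v := by
      rw [hw', map_add, hι, mul_zero]; abel
    rw [this]
    exact add_mem ha (mul_mem_koszulIdeal ej hqv)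

theorem isHomologyComplement_constSpan (A : Set (Fin n)) :
    IsHomologyComplement (varIdeal k A) (constSpan k A : Set _) := by
  classical
  -- Descending induction on `A`: `B` collects the variables already removed.
  suffices h : ∀ B : Finset (Fin n), IsHomologyComplement (varIdeal k (B : Set (Fin n))ᶜ)
      (constSpan k (B : Set (Fin n))ᶜ : Set _) by
    simpa using h (Aᶜ).toFinset
  intro B
  induction B using Finset.induction_on with
  | empty => simpa using isHomologyComplement_constSpan_univ
  | insert j B hj ih =>
    refine isHomologyComplement_constSpan_of_insert (j := j) (by simp) ?_
    have : insert j ((insert j B : Finset (Fin n)) : Set (Fin n))ᶜ = (B : Set (Fin n))ᶜ := by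
      ext i
      by_cases h : i = j <;> simp_all
    rwa [this]

/-! ### Adjoining one generator `a x_ℓ` -/

/-- The lift `q ↦ a e_ℓ ∧ q`. -/
noncomputable def wedgeLift {R : Type*} [CommRing R] (a : R) (l : Fin n) :
    ExteriorAlgebra R (Fin n → R) →ₗ[R] ExteriorAlgebra R (Fin n → R) :=
  a • LinearMap.mulLeft R (ExteriorAlgebra.ι R (Pi.single l 1))

theorem wedgeLift_apply {R : Type*} [CommRing R] (a : R) (l : Fin n)
    (q : ExteriorAlgebra R (Fin n → R)) :
    wedgeLift a l q = a • (ExteriorAlgebra.ι R (Pi.single l 1) * q) := rfl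

/-- The difference is `-a e_ℓ ∧ ∂ q`. The coefficients of `∂ q` lie in `(A)`, and `a` multiplies
`(A)` into `I`. -/
theorem koszulD_wedgeLift_sub_mem {I : Ideal (MvPolynomial (Fin n) k)} {A : Set (Fin n)}
    {a : MvPolynomial (Fin n) k} {l : Fin n} (ha : ∀ t ∈ A, X t * a ∈ I)
    {q : ExteriorAlgebra (MvPolynomial (Fin n) k) (Fin n → MvPolynomial (Fin n) k)}
    (hq : q ∈ constSpan k A) :
    koszulD X (wedgeLift a l q) - (a * X l) • q ∈ koszulIdeal I := by
  rw [wedgeLift_apply, map_smul, koszulD_ι_mul, koszulForm_single, smul_sub, mul_smul, sub_sub,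
    add_comm, ← sub_sub, sub_self, zero_sub, ← mul_smul_comm]
  refine neg_mem (mul_mem_koszulIdeal _ (smul_mem_koszulIdeal_iff_colon.2 ?_))
  refine koszulIdeal_mono (Ideal.span_le.2 ?_) (koszulD_mem_of_mem_constSpan hq)
  rintro _ ⟨t, ht, rfl⟩
  simpa [Submodule.mem_colon_singleton] using ha t ht

section Step

variable {I : Ideal (MvPolynomial (Fin n) k)} {A : Set (Fin n)} {a : MvPolynomial (Fin n) k}
  {l : Fin n}
  {F : Set (ExteriorAlgebra (MvPolynomial (Fin n) k) (Fin n → MvPolynomial (Fin n) k))}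

/-- The image of multiplication by `a x_ℓ` in homology vanishes. -/
theorem exists_smul_eq_of_koszulD_mem (hcolon : I.colon {a * X l} = varIdeal k A)
    (ha : ∀ t ∈ A, X t * a ∈ I)
    {v : ExteriorAlgebra (MvPolynomial (Fin n) k) (Fin n → MvPolynomial (Fin n) k)}
    (hv : koszulD X v ∈ koszulIdeal (varIdeal k A)) :
    ∃ q ∈ constSpan k A, ∃ y, (a * X l) • v - koszulD X (wedgeLift a l q + (a * X l) • y) ∈
      koszulIdeal I := by
  obtain ⟨q, hq, y, hy⟩ := (isHomologyComplement_constSpan A).spanning v hv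
  rw [← hcolon, ← smul_mem_koszulIdeal_iff_colon] at hy
  refine ⟨q, hq, y, ?_⟩
  have := sub_mem hy (koszulD_wedgeLift_sub_mem (l := l) ha hq)
  rw [map_add, map_smul]
  convert this using 1
  rw [smul_sub, smul_add]
  abel

/-- Writing `∂ w = b + a x_ℓ v` with `b ∈ I · K`, the cycle `v` modulo `(A)` represents the image of
`w` under the connecting map. As `a x_ℓ v` is a boundary modulo `I`, a correction of `w` by a lift
and a multiple of `a x_ℓ` is a cycle modulo `I`, to which `h` applies. -/
theorem spanning_sup (h : IsHomologyComplement I F) (hcolon : I.colon {a * X l} = varIdeal k A)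
    (ha : ∀ t ∈ A, X t * a ∈ I)
    (w : ExteriorAlgebra (MvPolynomial (Fin n) k) (Fin n → MvPolynomial (Fin n) k))
    (hw : koszulD X w ∈ koszulIdeal (I ⊔ Ideal.span {a * X l})) :
    ∃ f ∈ F, ∃ q ∈ constSpan k A, ∃ y, w - (f + wedgeLift a l q + koszulD X y) ∈
      koszulIdeal (I ⊔ Ideal.span {a * X l}) := by
  obtain ⟨b, hb, v, hv⟩ := exists_of_mem_koszulIdeal_sup hw
  have hv' : koszulD X v ∈ koszulIdeal (varIdeal k A) := by
    rw [← hcolon, ← smul_mem_koszulIdeal_iff_colon, ← map_smul]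
    have e1 : (a * X l) • v = koszulD X w - b := by rw [hv]; abel
    rw [e1, map_sub, koszulD_koszulD, zero_sub]
    exact neg_mem (map_mem_koszulIdeal _ hb)
  obtain ⟨q, hq, y, hy⟩ := exists_smul_eq_of_koszulD_mem hcolon ha hv'
  obtain ⟨f, hf, z, hz⟩ := h.spanning (w - (wedgeLift a l q + (a * X l) • y)) (by
    rw [map_sub, hv, add_sub_assoc]
    exact add_mem hb hy)
  refine ⟨f, hf, q, hq, z, ?_⟩
  have h1 : (a * X l) • y ∈ koszulIdeal (I ⊔ Ideal.span {a * X l}) :=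
    Submodule.smul_mem_smul (Ideal.mem_sup_right (Ideal.mem_span_singleton_self _))
      Submodule.mem_top
  convert add_mem (koszulIdeal_mono le_sup_left hz) h1 using 1
  abel

/-- The connecting map sends the class of the lift of `q` to that of `q` and kills `F`, which forces
`q = 0`. Then `f` is a boundary modulo `I`, because multiplication by `a x_ℓ` is zero on homology.
-/
theorem indep_sup (h : IsHomologyComplement I F) (hcolon : I.colon {a * X l} = varIdeal k A)
    (ha : ∀ t ∈ A, X t * a ∈ I)
    {f q y : ExteriorAlgebra (MvPolynomial (Fin n) k) (Fin n → MvPolynomial (Fin n) k)}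
    (hf : f ∈ F) (hq : q ∈ constSpan k A)
    (hy : f + wedgeLift a l q - koszulD X y ∈ koszulIdeal (I ⊔ Ideal.span {a * X l})) :
    f = 0 ∧ q = 0 := by
  obtain ⟨b, hb, v, hv⟩ := exists_of_mem_koszulIdeal_sup hy
  -- Applying `∂` to `hv` gives `a x_ℓ (q - ∂ v) ∈ I · K`.
  have hq0 : q = 0 := by
    refine indep_constSpan A q hq v ?_
    rw [← hcolon, ← smul_mem_koszulIdeal_iff_colon, smul_sub, ← map_smul]
    have e1 : (a * X l) • v = f + wedgeLift a l q - koszulD X y - b := by rw [hv]; abel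
    rw [e1]
    simp only [map_sub, map_add, koszulD_koszulD, sub_zero]
    convert sub_mem (sub_mem (map_mem_koszulIdeal (koszulD X) hb) (h.cycle f hf))
      (koszulD_wedgeLift_sub_mem (l := l) ha hq) using 1
    abel
  subst hq0
  refine ⟨?_, rfl⟩
  rw [map_zero, add_zero] at hv
  have hv' : koszulD X v ∈ koszulIdeal (varIdeal k A) := by
    rw [← hcolon, ← smul_mem_koszulIdeal_iff_colon, ← map_smul]
    have e1 : (a * X l) • v = f - koszulD X y - b := by rw [hv]; abel
    rw [e1, map_sub, map_sub, koszulD_koszulD, sub_zero]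
    exact sub_mem (h.cycle f hf) (map_mem_koszulIdeal _ hb)
  obtain ⟨q, hq, z, hz⟩ := exists_smul_eq_of_koszulD_mem hcolon ha hv'
  refine h.indep f hf (y + (wedgeLift a l q + (a * X l) • z)) ?_
  convert add_mem hb hz using 1
  rw [map_add (koszulD X) y, ← sub_sub, hv]
  abel

end Step

end PolynomialRing
-- Induction along the generators
section Filtration

variable {n m : ℕ} {k : Type*} [Field k]

/-- The ideal `(u_1, …, u_r)`. -/
noncomputable def initialIdeal (k : Type*) [Field k] (u : Fin m → (Fin n →₀ ℕ)) (r : ℕ) :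
    Ideal (MvPolynomial (Fin n) k) :=
  Ideal.span ((fun i => monomial (u i) (1 : k)) '' {i : Fin m | (i : ℕ) < r})

theorem initialIdeal_zero (u : Fin m → (Fin n →₀ ℕ)) :
    initialIdeal k u 0 = varIdeal k ∅ := by
  simp [initialIdeal, varIdeal]

theorem initialIdeal_succ (u : Fin m → (Fin n →₀ ℕ)) (j : Fin m) :
    initialIdeal k u (j + 1) = initialIdeal k u j ⊔ Ideal.span {monomial (u j) 1} := by
  have : {i : Fin m | (i : ℕ) < j + 1} = insert j {i : Fin m | (i : ℕ) < j} := by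
    ext i
    simp only [Set.mem_ofPred_eq, Set.mem_insert_iff, Fin.ext_iff]
    omega
  rw [initialIdeal, this, Set.image_insert_eq, Ideal.span_insert, sup_comm, initialIdeal]

theorem initialIdeal_eq {I : Ideal (MvPolynomial (Fin n) k)} (hI : IsMonomialIdeal I)
    {u : Fin m → (Fin n →₀ ℕ)} (hu : IsGeneratorOrder I u) : initialIdeal k u m = I := by
  apply le_antisymm
  · refine Ideal.span_le.2 ?_
    rintro _ ⟨i, -, rfl⟩
    exact (mem_iff_mem_multiples hu _).2 ⟨i, le_rfl⟩
  · obtain ⟨A, hA⟩ := hI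
    conv_lhs => rw [hA]
    refine Ideal.span_le.2 ?_
    rintro _ ⟨v, hv, rfl⟩
    have hvI : monomial v (1 : k) ∈ I := by rw [hA]; exact Ideal.subset_span ⟨v, hv, rfl⟩
    obtain ⟨j, hj⟩ := (mem_iff_mem_multiples hu v).1 hvI
    exact Ideal.mem_of_dvd _ (monomial_dvd_monomial.2 ⟨Or.inr hj, one_dvd _⟩)
      (Ideal.subset_span ⟨j, j.2, rfl⟩)

/-- Any variables that generate the colon ideal belong to `genSet`. For the first generator the
colon ideal is `(0) : u_1 = 0`, as `S` is a domain. -/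
theorem prevColon_eq_varIdeal {I : Ideal (MvPolynomial (Fin n) k)} {u : Fin m → (Fin n →₀ ℕ)}
    (hlin : HasLinearQuotients I u) (j : Fin m) :
    prevColon k u j = varIdeal k (genSet k u j) := by
  apply le_antisymm
  · rcases Nat.eq_zero_or_pos (j : ℕ) with h0 | hpos
    · have : {i | i < j} = (∅ : Set (Fin m)) := by
        ext i
        simp [Fin.lt_def, h0]
      intro f hf
      rw [prevColon, this, Submodule.mem_colon_singleton] at hf
      simp at hf
      simp [hf]
    · obtain ⟨A, hA⟩ := hlin.2 j hpos
      rw [hA]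
      refine varIdeal_mono fun i hi => ?_
      rw [genSet, Set.mem_ofPred_eq, hA]
      exact X_mem_varIdeal hi
  · refine Ideal.span_le.2 ?_
    rintro _ ⟨t, ht, rfl⟩
    exact ht

theorem monomial_sub_mul_X {a : Fin n →₀ ℕ} {l : Fin n} (hl : l ∈ a.support) :
    monomial (a - Finsupp.single l 1) (1 : k) * X l = monomial a 1 := by
  have : Finsupp.single l 1 ≤ a := by
    rw [Finsupp.single_le_iff]
    exact Nat.one_le_iff_ne_zero.2 (Finsupp.mem_support_iff.1 hl)
  rw [X, monomial_mul, one_mul, tsub_add_cancel_of_le this]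

theorem decomp_le {u : Fin m → (Fin n →₀ ℕ)} (v : multiples u) {i : Fin m} (h : u i ≤ v) :
    decomp u v ≤ i := by
  unfold decomp
  exact Finset.min'_le _ _ (by simpa using h)

theorem apply_decomp_le (u : Fin m → (Fin n →₀ ℕ)) (v : multiples u) :
    u (decomp u v) ≤ v := by
  classical
  exact (Finset.mem_filter.1 (Finset.min'_mem (Finset.univ.filter fun j => u j ≤ v.1) _)).2

/-- For `t ∈ set(u_j)`, an earlier generator divides `x_t u_j`, so `g(x_t u_j)` comes before `u_j`.
As `x_ℓ` divides `x_t u_j / g(x_t u_j)`, that generator still divides `x_t u_j / x_ℓ`. -/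
theorem X_mul_monomial_mem_initialIdeal {u : Fin m → (Fin n →₀ ℕ)} {j : Fin m} {l t : Fin n}
    (hl : IsNiceLiftIndex k u j l) (ht : t ∈ genSet k u j) :
    X t * monomial (u j - Finsupp.single l 1) (1 : k) ∈ initialIdeal k u j := by
  have hmem : monomial (u j + Finsupp.single t 1) (1 : k) ∈ initialIdeal k u j := by
    have := Submodule.mem_colon_singleton.1 (show X t ∈ prevColon k u j from ht)
    rwa [X, smul_eq_mul, monomial_mul, one_mul, add_comm] at this
  rw [initialIdeal, ← Set.image_image (fun s => monomial s (1 : k)) u,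
    mem_ideal_span_monomial_image] at hmem
  obtain ⟨_, ⟨i, hi, rfl⟩, hle⟩ := hmem (u j + Finsupp.single t 1) (by simp)
  set v := xMul u t j with hv
  have hd : decomp u v < j :=
    lt_of_le_of_lt (decomp_le v hle) hi
  have hdv : u (decomp u v) ≤ u j + Finsupp.single t 1 :=
    apply_decomp_le u v
  have hdiv : u (decomp u v) ≤ Finsupp.single t 1 + (u j - Finsupp.single l 1) := by
    intro s
    have h1 := hl.2 t ht s
    have h2 := hdv s
    have h3 : Finsupp.single l 1 s ≤ u j s := by
      refine (Finsupp.single_le_iff.2 ?_ : Finsupp.single l 1 ≤ u j) s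
      exact Nat.one_le_iff_ne_zero.2 (Finsupp.mem_support_iff.1 hl.1)
    rw [← hv] at h1
    have h4 : (v : Fin n →₀ ℕ) = u j + Finsupp.single t 1 := rfl
    simp only [h4, Finsupp.coe_add, Finsupp.coe_tsub, Pi.add_apply, Pi.sub_apply] at h1 h2 ⊢
    omega
  rw [X, monomial_mul, one_mul]
  exact Ideal.mem_of_dvd _ (monomial_dvd_monomial.2 ⟨Or.inr hdiv, one_dvd _⟩)
    (Ideal.subset_span ⟨_, hd, rfl⟩)

/-- The element `p + ∑_{j ≤ r} [u_j / x_{ℓ(u_j)}] e_{ℓ(u_j)} ∧ q_j`. -/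
noncomputable def liftSum (k : Type*) [Field k] (u : Fin m → (Fin n →₀ ℕ)) (l : Fin m → Fin n)
    (r : ℕ) (p : ExteriorAlgebra (MvPolynomial (Fin n) k) (Fin n → MvPolynomial (Fin n) k))
    (q : Fin m → ExteriorAlgebra (MvPolynomial (Fin n) k) (Fin n → MvPolynomial (Fin n) k)) :
    ExteriorAlgebra (MvPolynomial (Fin n) k) (Fin n → MvPolynomial (Fin n) k) :=
  p + ∑ j ∈ Finset.univ.filter fun j : Fin m => (j : ℕ) < r,
    wedgeLift (monomial (u j - Finsupp.single (l j) 1) 1) (l j) (q j)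

theorem liftSum_zero (u : Fin m → (Fin n →₀ ℕ)) (l : Fin m → Fin n)
    (p : ExteriorAlgebra (MvPolynomial (Fin n) k) (Fin n → MvPolynomial (Fin n) k))
    (q : Fin m → ExteriorAlgebra (MvPolynomial (Fin n) k) (Fin n → MvPolynomial (Fin n) k)) :
    liftSum k u l 0 p q = p := by
  simp [liftSum]

theorem liftSum_succ (u : Fin m → (Fin n →₀ ℕ)) (l : Fin m → Fin n) (j : Fin m)
    (p : ExteriorAlgebra (MvPolynomial (Fin n) k) (Fin n → MvPolynomial (Fin n) k))
    (q : Fin m → ExteriorAlgebra (MvPolynomial (Fin n) k) (Fin n → MvPolynomial (Fin n) k)) :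
    liftSum k u l (j + 1) p q = liftSum k u l j p q +
      wedgeLift (monomial (u j - Finsupp.single (l j) 1) 1) (l j) (q j) := by
  have : Finset.univ.filter (fun i : Fin m => (i : ℕ) < j + 1) =
      insert j (Finset.univ.filter fun i : Fin m => (i : ℕ) < j) := by
    ext i
    simp only [Finset.mem_filter, Finset.mem_univ, true_and, Finset.mem_insert, Fin.ext_iff]
    omega
  rw [liftSum, this, Finset.sum_insert (by simp), liftSum]
  abel

theorem liftSum_update (u : Fin m → (Fin n →₀ ℕ)) (l : Fin m → Fin n) (j : Fin m)
    (p q' : ExteriorAlgebra (MvPolynomial (Fin n) k) (Fin n → MvPolynomial (Fin n) k))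
    (q : Fin m → ExteriorAlgebra (MvPolynomial (Fin n) k) (Fin n → MvPolynomial (Fin n) k)) :
    liftSum k u l j p (Function.update q j q') = liftSum k u l j p q := by
  rw [liftSum, liftSum]
  congr 1
  refine Finset.sum_congr rfl fun i hi => ?_
  have : i ≠ j := by
    rintro rfl
    simp at hi
  rw [Function.update_of_ne this]

/-- The `k`-span of `1` and of the lifts attached to the first `r` generators. -/
def liftSet (k : Type*) [Field k] (u : Fin m → (Fin n →₀ ℕ)) (l : Fin m → Fin n) (r : ℕ) :
    Set (ExteriorAlgebra (MvPolynomial (Fin n) k) (Fin n → MvPolynomial (Fin n) k)) :=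
  {f | ∃ p ∈ constSpan k (∅ : Set (Fin n)), ∃ q, (∀ j, q j ∈ constSpan k (genSet k u j)) ∧
    f = liftSum k u l r p q}

/-- The second conjunct is carried along because `indep` only makes the lifted sum vanish, while
linear independence of the classes needs its components to vanish. The base case is the zero ideal,
with homology `k · 1`. -/
theorem isHomologyComplement_liftSet {I : Ideal (MvPolynomial (Fin n) k)}
    {u : Fin m → (Fin n →₀ ℕ)} (hlin : HasLinearQuotients I u) {l : Fin m → Fin n}
    (hl : ∀ j, IsNiceLiftIndex k u j (l j)) (r : ℕ) (hr : r ≤ m) :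
    IsHomologyComplement (initialIdeal k u r) (liftSet k u l r) ∧
      ∀ p ∈ constSpan k (∅ : Set (Fin n)), ∀ q : Fin m → _,
        (∀ j, q j ∈ constSpan k (genSet k u j)) → liftSum k u l r p q = 0 →
          p = 0 ∧ ∀ j : Fin m, (j : ℕ) < r → q j = 0 := by
  induction r with
  | zero =>
    have hset : liftSet k u l 0 = (constSpan k (∅ : Set (Fin n)) : Set _) := by
      ext f
      constructor
      · rintro ⟨p, hp, q, -, rfl⟩
        rwa [liftSum_zero]
      · exact fun hf => ⟨f, hf, 0, fun _ => zero_mem _, (liftSum_zero ..).symm⟩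
    rw [initialIdeal_zero, hset]
    refine ⟨isHomologyComplement_constSpan ∅, fun p _ q _ h => ?_⟩
    rw [liftSum_zero] at h
    exact ⟨h, fun j hj => absurd hj (Nat.not_lt_zero _)⟩
  | succ r ih =>
    obtain ⟨ih, ihinj⟩ := ih (Nat.le_of_succ_le hr)
    obtain ⟨j, rfl⟩ : ∃ j : Fin m, (j : ℕ) = r := ⟨⟨r, hr⟩, rfl⟩
    have hu := monomial_sub_mul_X (k := k) (hl j).1
    have ha : ∀ t ∈ genSet k u j, X t * monomial (u j - Finsupp.single (l j) 1) (1 : k) ∈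
        initialIdeal k u j := fun t ht => X_mul_monomial_mem_initialIdeal (hl j) ht
    have hcolon : (initialIdeal k u j).colon
        {monomial (u j - Finsupp.single (l j) 1) (1 : k) * X (l j)} =
          varIdeal k (genSet k u j) := by
      rw [hu]
      exact prevColon_eq_varIdeal hlin j
    have hsup : initialIdeal k u (j + 1) = initialIdeal k u j ⊔
        Ideal.span {monomial (u j - Finsupp.single (l j) 1) (1 : k) * X (l j)} := by
      rw [hu, initialIdeal_succ]
    have key : ∀ p ∈ constSpan k (∅ : Set (Fin n)), ∀ q : Fin m → _,
        (∀ j, q j ∈ constSpan k (genSet k u j)) → ∀ y,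
          liftSum k u l (j + 1) p q - koszulD X y ∈ koszulIdeal (initialIdeal k u (j + 1)) →
            liftSum k u l j p q = 0 ∧ q j = 0 := by
      intro p hp q hq y h
      rw [hsup, liftSum_succ] at h
      exact indep_sup ih hcolon ha ⟨p, hp, q, hq, rfl⟩ (hq j) h
    refine ⟨⟨?_, ?_, ?_⟩, ?_⟩
    · rintro _ ⟨p, hp, q, hq, rfl⟩
      rw [hsup, liftSum_succ, map_add]
      refine add_mem (koszulIdeal_mono le_sup_left (ih.cycle _ ⟨p, hp, q, hq, rfl⟩)) ?_
      rw [← sub_add_cancel (koszulD X (wedgeLift _ (l j) (q j)))]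
      exact add_mem (koszulIdeal_mono le_sup_left (koszulD_wedgeLift_sub_mem ha (hq j)))
        (Submodule.smul_mem_smul (Ideal.mem_sup_right (Ideal.mem_span_singleton_self _))
          Submodule.mem_top)
    · intro w hw
      rw [hsup] at hw ⊢
      obtain ⟨_, ⟨p, hp, q, hq, rfl⟩, q', hq', y, hy⟩ := spanning_sup ih hcolon ha w hw
      -- The sum up to `j` does not involve `q j`, so that entry is free to hold the new component
      -- `q'`.
      refine ⟨_, ⟨p, hp, Function.update q j q', fun i => ?_, rfl⟩, y, ?_⟩
      · by_cases h : i = j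
        · subst h
          simpa using hq'
        · simpa [h] using hq i
      · rwa [liftSum_succ, liftSum_update, Function.update_self]
    · rintro _ ⟨p, hp, q, hq, rfl⟩ y hy
      obtain ⟨h1, h2⟩ := key p hp q hq y hy
      rw [liftSum_succ, h1, h2, map_zero, add_zero]
    · intro p hp q hq h0
      obtain ⟨h1, h2⟩ := key p hp q hq 0 (by rw [h0, map_zero, sub_zero]; exact zero_mem _)
      obtain ⟨h3, h4⟩ := ihinj p hp q hq h1
      refine ⟨h3, fun i hi => ?_⟩
      rcases Nat.lt_succ_iff_lt_or_eq.1 hi with h | h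
      · exact h4 i h
      · rwa [Fin.ext h]

end Filtration
-- Passage from `S` to `R = S/I`
section Reduction

variable {n : ℕ} {k : Type*} [Field k] (I : Ideal (MvPolynomial (Fin n) k))

/-- Reduction modulo `I` on the Koszul complex of `k[x_1, …, x_n]`. -/
noncomputable def koszulMk :
    ExteriorAlgebra (MvPolynomial (Fin n) k) (Fin n → MvPolynomial (Fin n) k) →ₐ[
      MvPolynomial (Fin n) k]
      ExteriorAlgebra (MvPolynomial (Fin n) k ⧸ I) (Fin n → MvPolynomial (Fin n) k ⧸ I) :=
  ExteriorAlgebra.lift _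
    ⟨(ExteriorAlgebra.ι (MvPolynomial (Fin n) k ⧸ I)).restrictScalars (MvPolynomial (Fin n) k) ∘ₗ
      LinearMap.compLeft (Ideal.Quotient.mkₐ (MvPolynomial (Fin n) k) I).toLinearMap (Fin n),
      fun v => by
        rw [LinearMap.comp_apply, LinearMap.restrictScalars_apply]
        exact ExteriorAlgebra.ι_sq_zero _⟩

theorem koszulMk_ι (v : Fin n → MvPolynomial (Fin n) k) :
    koszulMk I (ExteriorAlgebra.ι _ v) =
      ExteriorAlgebra.ι _ (fun i => Ideal.Quotient.mk I (v i)) := by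
  rw [koszulMk, ExteriorAlgebra.lift_ι_apply]
  rfl

theorem koszulMk_ι_single (j : Fin n) :
    koszulMk I (ExteriorAlgebra.ι _ (Pi.single j 1)) = ExteriorAlgebra.ι _ (Pi.single j 1) := by
  rw [koszulMk_ι]
  congr 1
  funext i
  by_cases h : i = j
  · subst h; simp
  · simp [h]

theorem koszulMk_smul (r : MvPolynomial (Fin n) k)
    (w : ExteriorAlgebra (MvPolynomial (Fin n) k) (Fin n → MvPolynomial (Fin n) k)) :
    koszulMk I (r • w) = Ideal.Quotient.mk I r • koszulMk I w := by
  rw [map_smul, ← algebraMap_smul (MvPolynomial (Fin n) k ⧸ I) r]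
  rfl

theorem koszulMk_e (σ : Finset (Fin n)) :
    koszulMk I (e (MvPolynomial (Fin n) k) σ) = e (MvPolynomial (Fin n) k ⧸ I) σ := by
  rw [e_eq_ιMulti, e_eq_ιMulti, ExteriorAlgebra.ιMulti_apply, ExteriorAlgebra.ιMulti_apply,
    map_list_prod, List.map_ofFn]
  simp only [Function.comp_def, koszulMk_ι_single]

theorem koszulMk_koszulD
    (w : ExteriorAlgebra (MvPolynomial (Fin n) k) (Fin n → MvPolynomial (Fin n) k)) :
    koszulMk I (koszulD X w) = koszulD (vars I) (koszulMk I w) := by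
  induction w using CliffordAlgebra.left_induction with
  | algebraMap r =>
    rw [Algebra.algebraMap_eq_smul_one, map_smul (koszulD X), koszulD_one, smul_zero, map_zero,
      koszulMk_smul, map_smul (koszulD (vars I)), map_one, koszulD_one, smul_zero]
  | add a b ha hb => simp only [map_add, ha, hb]
  | ι_mul w v hw =>
    change koszulMk I (koszulD X (ExteriorAlgebra.ι _ v * w)) =
      koszulD (vars I) (koszulMk I (ExteriorAlgebra.ι _ v * w))
    rw [map_mul (koszulMk I), koszulMk_ι, koszulD_ι_mul, koszulD_ι_mul, map_sub, koszulMk_smul,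
      map_mul (koszulMk I), koszulMk_ι, hw]
    congr 2
    simp [koszulForm, Fintype.linearCombination_apply, vars]

theorem repr_koszulMk
    (w : ExteriorAlgebra (MvPolynomial (Fin n) k) (Fin n → MvPolynomial (Fin n) k))
    (σ : Finset (Fin n)) :
    (Pi.basisFun (MvPolynomial (Fin n) k ⧸ I) (Fin n)).ExteriorAlgebra.repr (koszulMk I w) σ =
      Ideal.Quotient.mk I
        ((Pi.basisFun (MvPolynomial (Fin n) k) (Fin n)).ExteriorAlgebra.repr w σ) := by
  have h : koszulMk I w = ∑ τ,
      Ideal.Quotient.mk I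
        ((Pi.basisFun (MvPolynomial (Fin n) k) (Fin n)).ExteriorAlgebra.repr w τ) • e _ τ := by
    conv_lhs => rw [← sum_repr_smul_e w]
    simp only [map_sum (koszulMk I), koszulMk_smul, koszulMk_e]
  rw [h]
  exact congrFun
    ((Pi.basisFun (MvPolynomial (Fin n) k ⧸ I) (Fin n)).ExteriorAlgebra.repr_sum_self _) σ

/-- Reduction acts coefficientwise in the bases `e σ`. This turns statements modulo `I · K` into
equations in the complex over `R`. -/
theorem koszulMk_eq_zero_iff
    {w : ExteriorAlgebra (MvPolynomial (Fin n) k) (Fin n → MvPolynomial (Fin n) k)} :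
    koszulMk I w = 0 ↔ w ∈ koszulIdeal I := by
  rw [mem_koszulIdeal_iff_repr]
  constructor
  · intro h σ
    rw [← Ideal.Quotient.eq_zero_iff_mem, ← repr_koszulMk, h]
    simp
  · intro h
    refine (Pi.basisFun _ (Fin n)).ExteriorAlgebra.ext_elem fun σ => ?_
    rw [repr_koszulMk, Ideal.Quotient.eq_zero_iff_mem.2 (h σ)]
    simp

theorem koszulMk_surjective : Function.Surjective (koszulMk I) := by
  intro z
  rw [← sum_repr_smul_e z]
  choose g hg using Ideal.Quotient.mk_surjective (I := I)
  refine ⟨∑ σ, g ((Pi.basisFun _ (Fin n)).ExteriorAlgebra.repr z σ) • e _ σ, ?_⟩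
  simp only [map_sum, koszulMk_smul, koszulMk_e, hg]

theorem monomialChain_eq_koszulMk (a : Fin n →₀ ℕ) (l : Fin n) (σ : Finset (Fin n)) :
    monomialChain I a l σ =
      koszulMk I (wedgeLift (monomial (a - Finsupp.single l 1) 1) l (e _ σ)) := by
  rw [wedgeLift_apply, koszulMk_smul, map_mul, koszulMk_ι_single, koszulMk_e, monomialChain]

theorem monomialChain_mem (a : Fin n →₀ ℕ) (l : Fin n) (σ : Finset (Fin n)) :
    monomialChain I a l σ ∈
      ⋀[MvPolynomial (Fin n) k ⧸ I]^(σ.card + 1) (Fin n → MvPolynomial (Fin n) k ⧸ I) := by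
  refine Submodule.smul_mem _ _ ?_
  rw [ExteriorAlgebra.exteriorPower, pow_succ']
  exact Submodule.mul_mem_mul ⟨_, rfl⟩ (e_mem_exteriorPower σ)

end Reduction

/-! ### Extracting one exterior degree -/

section Degree

variable {n : ℕ} {R : Type*} [CommRing R]

/-- The projection of `⋀ Rⁿ` onto `⋀^i Rⁿ`. -/
noncomputable def degreeProj (R : Type*) [CommRing R] (n i : ℕ) :
    ExteriorAlgebra R (Fin n → R) →ₗ[R] ExteriorAlgebra R (Fin n → R) :=
  GradedAlgebra.proj (fun i : ℕ => ⋀[R]^i (Fin n → R)) i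

theorem degreeProj_of_mem {i : ℕ} {w : ExteriorAlgebra R (Fin n → R)}
    (hw : w ∈ ⋀[R]^i (Fin n → R)) : degreeProj R n i w = w := by
  rw [degreeProj, GradedAlgebra.proj_apply]
  exact DirectSum.decompose_of_mem_same _ hw

theorem degreeProj_of_mem_ne {i j : ℕ} {w : ExteriorAlgebra R (Fin n → R)}
    (hw : w ∈ ⋀[R]^j (Fin n → R)) (h : j ≠ i) : degreeProj R n i w = 0 := by
  rw [degreeProj, GradedAlgebra.proj_apply]
  exact DirectSum.decompose_of_mem_ne _ hw h

/-- As `∂` lowers degree by one, the degree `i` part of `∂ w` is the boundary of the degree `i + 1`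
part of `w`. -/
theorem degreeProj_koszulD_mem (x : Fin n → R) (i : ℕ) (w : ExteriorAlgebra R (Fin n → R)) :
    degreeProj R n i (koszulD x w) ∈ boundaries x i := by
  induction w using DirectSum.Decomposition.inductionOn (fun i : ℕ => ⋀[R]^i (Fin n → R)) with
  | zero => simp only [map_zero]; exact zero_mem _
  | add a b ha hb => simp only [map_add]; exact add_mem ha hb
  | @homogeneous j w =>
    obtain ⟨w, hw⟩ := w
    rcases j with _ | j
    · rw [ExteriorAlgebra.exteriorPower, pow_zero] at hw
      obtain ⟨r, hr⟩ := Submodule.mem_one.1 hw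
      change degreeProj R n i (koszulD x w) ∈ _
      rw [← hr, Algebra.algebraMap_eq_smul_one, map_smul, koszulD_one, smul_zero, map_zero]
      exact zero_mem _
    · by_cases h : j = i
      · subst h
        rw [degreeProj_of_mem (koszulD_mem x j hw)]
        exact ⟨w, hw, rfl⟩
      · rw [degreeProj_of_mem_ne (koszulD_mem x j hw) h]
        exact zero_mem _

end Degree

/-! ### Cycles, linear independence and spanning over `R` -/

section Main

variable {n m : ℕ} {k : Type*} [Field k] {I : Ideal (MvPolynomial (Fin n) k)}
  {u : Fin m → (Fin n →₀ ℕ)} {l : Fin m → Fin n}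

theorem monomialChain_mem_cycles (hI : IsMonomialIdeal I) (hlin : HasLinearQuotients I u)
    (hl : ∀ j, IsNiceLiftIndex k u j (l j)) {i : ℕ} (p : BasisIndex k u i) :
    monomialChain I (u p.1.1) (l p.1.1) p.1.2 ∈ cycles (vars I) i := by
  obtain ⟨⟨j, σ⟩, hσ, rfl⟩ := p
  refine ⟨monomialChain_mem I _ _ σ, ?_⟩
  change koszulD (vars I) (monomialChain I (u j) (l j) σ) = 0
  rw [monomialChain_eq_koszulMk, ← koszulMk_koszulD, koszulMk_eq_zero_iff,
    ← initialIdeal_eq hI hlin.1]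
  obtain ⟨h, -⟩ := isHomologyComplement_liftSet hlin hl m le_rfl
  -- A single chain is the lifted sum whose only nonzero component is `e σ`, at `j`.
  refine h.cycle _ ⟨0, zero_mem _, Pi.single j (e _ σ), fun j' => ?_, ?_⟩
  · by_cases hj : j' = j
    · subst hj
      simpa using e_mem_constSpan hσ
    · simp [hj]
  · rw [liftSum, zero_add, Finset.sum_eq_single j]
    · simp
    · intro j' _ hj
      simp [hj]
    · simp

theorem linearIndependent_homologyClass (hI : IsMonomialIdeal I) (hlin : HasLinearQuotients I u)
    (hl : ∀ j, IsNiceLiftIndex k u j (l j)) (i : ℕ) :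
    LinearIndependent k fun p : BasisIndex k u i => homologyClass (vars I) i
      ⟨monomialChain I (u p.1.1) (l p.1.1) p.1.2, monomialChain_mem_cycles hI hlin hl p⟩ := by
  classical
  rw [linearIndependent_iff']
  intro s g hg p₀ hp₀
  -- Grouping the relation by generator makes it the reduction of one lifted sum.
  let q : Fin m → ExteriorAlgebra (MvPolynomial (Fin n) k) (Fin n → MvPolynomial (Fin n) k) :=
    fun j => ∑ p ∈ s with p.1.1 = j, g p • e _ p.1.2
  have hq (j) : q j ∈ constSpan k (genSet k u j) := by
    refine sum_mem fun p hp => Submodule.smul_mem _ _ (e_mem_constSpan ?_)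
    obtain ⟨-, rfl⟩ := Finset.mem_filter.1 hp
    exact p.2.1
  obtain ⟨h, hinj⟩ := isHomologyComplement_liftSet hlin hl m le_rfl
  have hmk : koszulMk I (liftSum k u l m 0 q) =
      ∑ p ∈ s, g p • monomialChain I (u p.1.1) (l p.1.1) p.1.2 := by
    have hf : Finset.univ.filter (fun j : Fin m => (j : ℕ) < m) = Finset.univ :=
      Finset.filter_true_of_mem fun j _ => j.2
    rw [liftSum, zero_add, hf, map_sum, ← Finset.sum_fiberwise s (fun p => p.1.1)]
    refine Finset.sum_congr rfl fun j _ => ?_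
    simp only [q, map_sum]
    refine Finset.sum_congr rfl fun p hp => ?_
    obtain ⟨-, rfl⟩ := Finset.mem_filter.1 hp
    rw [monomialChain_eq_koszulMk, ← algebraMap_smul (MvPolynomial (Fin n) k) (g p) (e _ _),
      map_smul, map_smul, algebraMap_smul]
  have hb : ∑ p ∈ s, g p • monomialChain I (u p.1.1) (l p.1.1) p.1.2 ∈ boundaries (vars I) i := by
    have : (∑ p ∈ s, g p • homologyClass (vars I) i
        ⟨monomialChain I (u p.1.1) (l p.1.1) p.1.2, monomialChain_mem_cycles hI hlin hl p⟩) =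
        Submodule.Quotient.mk (∑ p ∈ s, g p • (⟨monomialChain I (u p.1.1) (l p.1.1) p.1.2,
          monomialChain_mem_cycles hI hlin hl p⟩ : cycles (vars I) i)) := by
      exact (map_sum (((boundaries (vars I) i).submoduleOf (cycles (vars I) i)).mkQ.restrictScalars k)
        _ s).symm
    rw [this, Submodule.Quotient.mk_eq_zero, Submodule.submoduleOf, Submodule.mem_comap] at hg
    simpa using hg
  obtain ⟨y, -, hy⟩ := hb
  obtain ⟨y, rfl⟩ := koszulMk_surjective I y
  have h0 : liftSum k u l m 0 q = 0 := by
    refine h.indep _ ⟨0, zero_mem _, q, hq, rfl⟩ y ?_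
    rw [initialIdeal_eq hI hlin.1, ← koszulMk_eq_zero_iff, map_sub, koszulMk_koszulD, hy, hmk,
      sub_self]
  have hq0 := (hinj 0 (zero_mem _) q hq h0).2 p₀.1.1 p₀.1.1.2
  -- Within one `q j` the sets `σ` are distinct, so the coefficient at `e σ` isolates `g p₀`.
  have h1 := congrArg (fun w =>
    (Pi.basisFun (MvPolynomial (Fin n) k) (Fin n)).ExteriorAlgebra.repr w p₀.1.2) hq0
  simp only [q, map_sum, map_zero, Finsupp.coe_zero, Pi.zero_apply, Finsupp.finsetSum_apply] at h1
  have hmem : p₀ ∈ s.filter fun p => p.1.1 = p₀.1.1 := Finset.mem_filter.2 ⟨hp₀, rfl⟩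
  rw [Finset.sum_eq_single_of_mem p₀ hmem] at h1
  · rw [← algebraMap_smul (MvPolynomial (Fin n) k) (g p₀) (e _ _), map_smul, e,
      Module.Basis.repr_self] at h1
    simpa using h1
  · intro p hp hne
    have : p.1.2 ≠ p₀.1.2 := fun h2 =>
      hne (Subtype.ext (Prod.ext (Finset.mem_filter.1 hp).2 h2))
    rw [← algebraMap_smul (MvPolynomial (Fin n) k) (g p) (e _ _), map_smul, e,
      Module.Basis.repr_self]
    simp [this]

theorem degreeProj_koszulMk_wedgeLift_mem {i : ℕ} {j : Fin m}
    {q : ExteriorAlgebra (MvPolynomial (Fin n) k) (Fin n → MvPolynomial (Fin n) k)}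
    (hq : q ∈ constSpan k (genSet k u j)) :
    degreeProj (MvPolynomial (Fin n) k ⧸ I) n i
      (koszulMk I (wedgeLift (monomial (u j - Finsupp.single (l j) 1) 1) (l j) q)) ∈
      Submodule.span k (Set.range fun p : BasisIndex k u i =>
        monomialChain I (u p.1.1) (l p.1.1) p.1.2) := by
  rw [constSpan] at hq
  induction hq using Submodule.span_induction with
  | mem x h =>
    obtain ⟨σ, hσ, rfl⟩ := h
    rw [← monomialChain_eq_koszulMk]
    by_cases hc : σ.card + 1 = i
    · rw [degreeProj_of_mem (hc ▸ monomialChain_mem I _ _ σ)]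
      exact Submodule.subset_span ⟨⟨(j, σ), hσ, hc⟩, rfl⟩
    · rw [degreeProj_of_mem_ne (monomialChain_mem I _ _ σ) hc]
      exact zero_mem _
  | zero => simp only [map_zero]; exact zero_mem _
  | add a b _ _ ha hb => simp only [map_add]; exact add_mem ha hb
  | smul c a _ ha =>
    rw [← algebraMap_smul (MvPolynomial (Fin n) k) c a, map_smul, koszulMk_smul, map_smul]
    exact Submodule.smul_mem _ c ha

/-- Discards the summand `k · 1`, which contributes to degree `0` only. -/
theorem degreeProj_koszulMk_constSpan_empty {i : ℕ} (hi : 1 ≤ i)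
    {q : ExteriorAlgebra (MvPolynomial (Fin n) k) (Fin n → MvPolynomial (Fin n) k)}
    (hq : q ∈ constSpan k (∅ : Set (Fin n))) :
    degreeProj (MvPolynomial (Fin n) k ⧸ I) n i (koszulMk I q) = 0 := by
  rw [constSpan] at hq
  induction hq using Submodule.span_induction with
  | mem x h =>
    obtain ⟨σ, hσ, rfl⟩ := h
    have : σ = ∅ := by simpa using hσ
    rw [koszulMk_e]
    refine degreeProj_of_mem_ne (e_mem_exteriorPower σ) ?_
    simp only [this, Finset.card_empty]
    omega
  | zero => simp only [map_zero]
  | add a b _ _ ha hb => simp only [map_add, ha, hb, add_zero]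
  | smul c a _ ha =>
    rw [← algebraMap_smul (MvPolynomial (Fin n) k) c a, koszulMk_smul, map_smul, ha, smul_zero]

theorem span_homologyClass (hI : IsMonomialIdeal I) (hlin : HasLinearQuotients I u)
    (hl : ∀ j, IsNiceLiftIndex k u j (l j)) {i : ℕ} (hi : 1 ≤ i) :
    ⊤ ≤ Submodule.span k (Set.range fun p : BasisIndex k u i => homologyClass (vars I) i
      ⟨monomialChain I (u p.1.1) (l p.1.1) p.1.2, monomialChain_mem_cycles hI hlin hl p⟩) := by
  -- A class exists only for a cycle, so the span induction has to produce the cycle condition along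
  -- with the membership.
  have hcls : ∀ t ∈ Submodule.span k (Set.range fun p : BasisIndex k u i =>
      monomialChain I (u p.1.1) (l p.1.1) p.1.2), ∃ ht : t ∈ cycles (vars I) i,
        homologyClass (vars I) i ⟨t, ht⟩ ∈ Submodule.span k
          (Set.range fun p : BasisIndex k u i => homologyClass (vars I) i
            ⟨monomialChain I (u p.1.1) (l p.1.1) p.1.2,
              monomialChain_mem_cycles hI hlin hl p⟩) := by
    intro t ht
    induction ht using Submodule.span_induction with
    | mem x h =>
      obtain ⟨p, rfl⟩ := h
      exact ⟨monomialChain_mem_cycles hI hlin hl p, Submodule.subset_span ⟨p, rfl⟩⟩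
    | zero => exact ⟨zero_mem _, zero_mem _⟩
    | add a b _ _ ha hb =>
      obtain ⟨ha, ha'⟩ := ha
      obtain ⟨hb, hb'⟩ := hb
      exact ⟨add_mem ha hb, add_mem ha' hb'⟩
    | smul c a _ ha =>
      obtain ⟨ha, ha'⟩ := ha
      have hc : c • a ∈ cycles (vars I) i := by
        rw [← algebraMap_smul (MvPolynomial (Fin n) k ⧸ I) c a]
        exact Submodule.smul_mem _ _ ha
      exact ⟨hc, Submodule.smul_mem _ c ha'⟩
  rintro x -
  obtain ⟨⟨z, hz⟩, rfl⟩ := Submodule.Quotient.mk_surjective _ x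
  obtain ⟨w, rfl⟩ := koszulMk_surjective I z
  obtain ⟨h, -⟩ := isHomologyComplement_liftSet hlin hl m le_rfl
  rw [initialIdeal_eq hI hlin.1] at h
  obtain ⟨_, ⟨p, hp, q, hq, rfl⟩, y, hy⟩ := h.spanning w (by
    rw [← koszulMk_eq_zero_iff, koszulMk_koszulD]
    exact hz.2)
  rw [← koszulMk_eq_zero_iff, map_sub, sub_eq_zero, map_add, koszulMk_koszulD] at hy
  -- `h.spanning` mixes all degrees. Projection fixes the given cycle, keeps the lifts with `|σ| + 1
  -- = i`, and sends the boundary to a boundary.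
  have hproj := congrArg (degreeProj (MvPolynomial (Fin n) k ⧸ I) n i) hy
  rw [degreeProj_of_mem hz.1, map_add] at hproj
  obtain ⟨ht, ht'⟩ := hcls (degreeProj _ n i (koszulMk I (liftSum k u l m p q))) (by
    rw [liftSum, map_add, map_add, degreeProj_koszulMk_constSpan_empty hi hp, zero_add, map_sum,
      map_sum]
    exact sum_mem fun j _ => degreeProj_koszulMk_wedgeLift_mem (hq j))
  convert ht' using 1
  refine (Submodule.Quotient.eq _).2 ?_
  change koszulMk I w - degreeProj _ n i (koszulMk I (liftSum k u l m p q)) ∈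
    boundaries (vars I) i
  rw [hproj, add_sub_cancel_left]
  exact degreeProj_koszulD_mem _ _ _

end Main
end KoszulMonomialBasis

open KoszulMonomialBasis in
theorem mainTheorem7 {k : Type*} [Field k] {n : ℕ} (I : Ideal (MvPolynomial (Fin n) k))
    (hI : IsMonomialIdeal I) {m : ℕ} (u : Fin m → (Fin n →₀ ℕ))
    (hlin : HasLinearQuotients I u) (hdeg : DegreeIncreasing u)
    (hreg : IsRegularDecomp k u) (hnice : HasNiceKoszulLifts k u) :
    ∀ l : Fin m → Fin n, (∀ j, IsNiceLiftIndex k u j (l j)) →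
      ∀ i : ℕ, 1 ≤ i →
        ∃ hz : ∀ p : BasisIndex k u i,
            monomialChain I (u p.1.1) (l p.1.1) p.1.2 ∈ cycles (vars I) i,
          ∃ b : Module.Basis (BasisIndex k u i) k (KoszulHomology (vars I) i),
            ∀ p : BasisIndex k u i, b p = homologyClass (vars I) i
              ⟨monomialChain I (u p.1.1) (l p.1.1) p.1.2, hz p⟩ := by
  intro l hl i hi
  refine ⟨fun p => monomialChain_mem_cycles hI hlin hl p,
    .mk (linearIndependent_homologyClass hI hlin hl i) (span_homologyClass hI hlin hl hi),
    fun p => ?_⟩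
  rw [Module.Basis.mk_apply]
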